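/- Let $\Pi$ be a Lévy measure on $\mathbb R$ (that is, $\Pi(\{0\})=0$ and $\int_{\mathbb R}\min(1,u^2)\,\Pi(du)<\infty$), and let $U=(U_t)_{t\ge 0}$ be a real Lévy process ($U_0=0$ a.s., independent increments, a.s. càdlàg paths) without Gaussian part and with Lévy measure $\Pi$, so that for $0\le s\le t$ and $\xi\in\mathbb R$ $$E\,e^{i\xi (U_t-U_s)}=\exp\Bigl[(t-s)\int_{\mathbb R}\bigl(e^{i\xi u}-1-i\xi u\,1_{|u|\le 1}\bigr)\Pi(du)\Bigr].$$ Let $a:\mathbb R\to\mathbb R$ be globally Lipschitz, let $x\in\mathbb R$, and let $X(x,\cdot)$ be the solution of $dX(t)=a(X(t))\,dt+dU_t$, $X(0)=x$, i.e. almost surely $X(x,t)=x+\int_0^t a(X(x,s))\,ds+U_t$ for all $t\ge0$. Define $$\rho_1(\varepsilon)=\Bigl[\varepsilon\ln\frac1\varepsilon\Bigr]^{-1}\int_{\mathbb R}\min(|u|,\varepsilon)\,\Pi(du)\quad(0<\varepsilon<1),\qquad \boldsymbol\rho_1=\liminf_{\varepsilon\to0+}\rho_1(\varepsilon)\in[0,+\infty].$$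 For an integer $k\ge 0$ let $CB^k(\mathbb R)$ be the set of real-valued functions on $\mathbb R$ that have $k$ Sobolev (weak, locally integrable) derivatives and whose $k$-th derivative is essentially bounded; $CB^0(\mathbb R)=L_\infty(\mathbb R)$. Assume that $\boldsymbol\rho_1<+\infty$ and that $\Pi$ is one-sided, i.e. $\Pi((-\infty,0))\cdot\Pi((0,+\infty))=0$. Then for every integer $k\ge0$ and every $t\ge 0$ with $t\,\boldsymbol\rho_1<k+1$: if the law of $X(x,t)$ has a density $p_{x,t}$ with respect to Lebesgue measure on $\mathbb R$, then $p_{x,t}\notin CB^k(\mathbb R)$. -/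

import Mathlib

open MeasureTheory ProbabilityTheory Filter Topology Set
open scoped NNReal ENNReal

/-- A Lévy measure on `ℝ`: no mass at `0`, and `∫ min(1, u²) Π(du) < ∞`. -/
structure IsLevyMeasure (Pi : Measure ℝ) : Prop where
  zero : Pi {0} = 0
  lintegral_lt_top : ∫⁻ u, ENNReal.ofReal (min 1 (u ^ 2)) ∂Pi < ∞

/-- The characteristic exponent
`ψ(ξ) = ∫ (exp(iξu) - 1 - iξu 1_{|u| ≤ 1}) Π(du)` of a Lévy process without Gaussian part and
without additional drift. -/
noncomputable def levyExponent (Pi : Measure ℝ) (ξ : ℝ) : ℂ :=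
  ∫ u, (Complex.exp ((ξ * u : ℝ) * Complex.I) - 1
    - (if |u| ≤ 1 then ((ξ * u : ℝ) : ℂ) * Complex.I else 0)) ∂Pi

/-- Right-continuous with left limits on `[0, ∞)`. -/
def IsCadlagPath (f : ℝ≥0 → ℝ) : Prop :=
  ∀ t, ContinuousWithinAt f (Ici t) t ∧ ∃ l, Tendsto f (𝓝[<] t) (𝓝 l)

/-- `U` is a real Lévy process with Lévy measure `Pi`, without Gaussian part, whose small jumps
(`|u| ≤ 1`) are compensated, i.e. with generating triplet `(0, 0, Π)`. -/
structure IsPureJumpLevyProcess {Ω : Type*} [MeasurableSpace Ω] (U : ℝ≥0 → Ω → ℝ)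
    (Pi : Measure ℝ) (P : Measure Ω) : Prop where
  aemeasurable : ∀ t, AEMeasurable (U t) P
  zero : ∀ᵐ ω ∂P, U 0 ω = 0
  indep : HasIndepIncrements U P
  charFun_increment : ∀ s t : ℝ≥0, s ≤ t → ∀ ξ : ℝ,
    charFun (P.map (U t - U s)) ξ = Complex.exp ((((t : ℝ) - (s : ℝ) : ℝ) : ℂ) * levyExponent Pi ξ)
  cadlag : ∀ᵐ ω ∂P, IsCadlagPath (fun t => U t ω)

/-- `X` solves the Cauchy problem `dX(t) = a(X(t)) dt + dU_t`, `X(0) = x`: almost surely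
`X(t) = x + ∫₀ᵗ a(X(s)) ds + U_t` for all `t ≥ 0` (`U_0 = 0`). -/
structure IsSDESolution {Ω : Type*} [MeasurableSpace Ω] (X : ℝ≥0 → Ω → ℝ) (x : ℝ) (a : ℝ → ℝ)
    (U : ℝ≥0 → Ω → ℝ) (P : Measure Ω) : Prop where
  aemeasurable : ∀ t, AEMeasurable (X t) P
  eqn : ∀ᵐ ω ∂P, ∀ t : ℝ≥0,
    IntervalIntegrable (fun s : ℝ => a (X s.toNNReal ω)) volume 0 t ∧
      X t ω = x + (∫ s in (0 : ℝ)..t, a (X s.toNNReal ω)) + U t ω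

/-- `p` is a density of the measure `μ` with respect to Lebesgue measure on `ℝ`. -/
structure IsLebesgueDensity (p : ℝ → ℝ) (μ : Measure ℝ) : Prop where
  aemeasurable : AEMeasurable p volume
  nonneg : ∀ᵐ y, 0 ≤ p y
  eq_withDensity : μ = volume.withDensity (fun y => ENNReal.ofReal (p y))

/-- `ρ_r(ε) = [ε^r ln(1/ε)]⁻¹ ∫ (|u| ∧ ε)^r Π(du)` (meaningful for `0 < ε < 1`). -/
noncomputable def orderFun (r : ℕ) (Pi : Measure ℝ) (ε : ℝ) : ℝ≥0∞ :=
  (∫⁻ u, ENNReal.ofReal ((min |u| ε) ^ r) ∂Pi) / ENNReal.ofReal (ε ^ r * Real.log (1 / ε))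

/-- The upper order index of power `r` in dimension one, `liminf_{ε → 0+} ρ_r(ε) ∈ [0, ∞]`. -/
noncomputable def upperOrderIndex (r : ℕ) (Pi : Measure ℝ) : ℝ≥0∞ :=
  liminf (orderFun r Pi) (𝓝[>] (0 : ℝ))

/-- `g` is the Sobolev (weak) derivative of order `j` of the function `f` on `ℝ`. -/
def HasWeakDeriv (j : ℕ) (f g : ℝ → ℝ) : Prop :=
  LocallyIntegrable f ∧ LocallyIntegrable g ∧
    ∀ φ : ℝ → ℝ, ContDiff ℝ (⊤ : ℕ∞) φ → HasCompactSupport φ →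
      ∫ y, f y * iteratedDeriv j φ y = (-1) ^ j * ∫ y, g y * φ y

/-- The class `CB^k(ℝ)`: functions with `k` Sobolev derivatives, the `k`-th one being
(essentially) bounded; `CB^0(ℝ) = L_∞(ℝ)`. -/
def MemCB (k : ℕ) (f : ℝ → ℝ) : Prop :=
  ∃ D : ℕ → ℝ → ℝ, (∀ j ≤ k, HasWeakDeriv j f (D j)) ∧ MemLp (D k) ∞ volume

/-! ### Compound Poisson laws -/

/-! Near the edge of its support the law of `X t` carries too much mass for its density to lie in
`CB^k`; two estimates of that mass conflict.

Finiteness of the index forces `∫ min(|u|, 1) dΠ < ∞`, so the compensator of the small jumps can be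
split off as a drift. With `σ = ±1` the direction of the jumps, `S_t = σ (U_t + d t)`, `d` being
`smallJumpDrift Pi`, then has nondecreasing paths. Comparing solution paths through a Grönwall
argument yields a point `z` with `0 ≤ σ (X_t - z) ≤ S_t exp(L t)` almost surely (`exists_edge`).

Lower estimate (`le_measure_monotonePart_le`): if `t ∫ min(|u|, ε) dΠ ≤ κ ε`, then over `[0, t]`
jumps of size at least `ε` are absent with probability at least `exp(-κ)`, and the remaining ones
have mean sum at most `κ ε`; Markov's inequality gives `P(S_t ≤ 2 κ ε) ≥ exp(-κ) / 2`. If `t ρ₁ < m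
< k + 1`, then `κ = m log(1/ε)` is admissible for arbitrarily small `ε`, and the bound reads `ε ^ m
/ 2`.

Upper estimate (`measure_le_of_memCB`): a `CB^k` density that vanishes on one side of `z` gives mass
`O(δ ^ (k + 1))` to the points within `δ` of `z`. For `δ` of order `ε log(1/ε)` this is eventually
smaller than `ε ^ m / 2`, since `m < k + 1`. -/

/-- The `n`-fold convolution power of a measure on `ℝ`. -/
noncomputable def convPow (Q : Measure ℝ) : ℕ → Measure ℝ
  | 0 => Measure.dirac 0
  | n + 1 => (convPow Q n).conv Q

/-- The compound Poisson law with finite jump measure `Q`. -/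
noncomputable def compoundPoisson (Q : Measure ℝ) : Measure ℝ :=
  Measure.sum fun n : ℕ =>
    ENNReal.ofReal (Real.exp (-Q.real univ) / n.factorial) • convPow Q n

section CompoundPoisson

variable (Q : Measure ℝ) [IsFiniteMeasure Q]

instance isFiniteMeasure_convPow (n : ℕ) : IsFiniteMeasure (convPow Q n) := by
  induction n with
  | zero => simp only [convPow]; infer_instance
  | succ n ih => simp only [convPow]; infer_instance

theorem lintegral_convPow_succ (n : ℕ) {f : ℝ → ℝ≥0∞} (hf : Measurable f) :
    ∫⁻ u, f u ∂convPow Q (n + 1) = ∫⁻ u, ∫⁻ v, f (u + v) ∂Q ∂convPow Q n := by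
  rw [convPow, Measure.lintegral_conv hf]

theorem convPow_univ (n : ℕ) : convPow Q n univ = Q univ ^ n := by
  induction n with
  | zero => simp [convPow]
  | succ n ih =>
    rw [← lintegral_one, lintegral_convPow_succ Q n measurable_const]
    simp [ih, pow_succ, mul_comm]

theorem charFun_convPow (n : ℕ) (ξ : ℝ) : charFun (convPow Q n) ξ = charFun Q ξ ^ n := by
  induction n with
  | zero => simp [convPow, charFun_dirac]
  | succ n ih => rw [convPow, charFun_conv, ih, pow_succ]

theorem tsum_poisson_weights :
    ∑' n : ℕ, ENNReal.ofReal (Real.exp (-Q.real univ) / n.factorial) * Q univ ^ n = 1 := by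
  have h : ∀ n : ℕ, ENNReal.ofReal (Real.exp (-Q.real univ) / n.factorial) * Q univ ^ n
      = ENNReal.ofReal (Real.exp (-Q.real univ) * (Q.real univ ^ n / n.factorial)) := by
    intro n
    rw [← ofReal_measureReal, ← ENNReal.ofReal_pow measureReal_nonneg,
      ← ENNReal.ofReal_mul (by positivity)]
    congr 1
    ring
  simp_rw [h]
  have hs : HasSum (fun n : ℕ => Real.exp (-Q.real univ) * (Q.real univ ^ n / n.factorial)) 1 := by
    have := (NormedSpace.expSeries_div_hasSum_exp (Q.real univ)).mul_left
      (Real.exp (-Q.real univ))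
    rwa [← Real.exp_eq_exp_ℝ, ← Real.exp_add, neg_add_cancel, Real.exp_zero] at this
  rw [← ENNReal.ofReal_tsum_of_nonneg (fun n => by positivity) hs.summable, hs.tsum_eq,
    ENNReal.ofReal_one]

omit [IsFiniteMeasure Q] in
theorem compoundPoisson_apply {s : Set ℝ} (hs : MeasurableSet s) :
    compoundPoisson Q s =
      ∑' n : ℕ, ENNReal.ofReal (Real.exp (-Q.real univ) / n.factorial) * convPow Q n s := by
  simp [compoundPoisson, Measure.sum_apply _ hs]

instance isProbabilityMeasure_compoundPoisson : IsProbabilityMeasure (compoundPoisson Q) := by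
  constructor
  rw [compoundPoisson_apply Q MeasurableSet.univ]
  simp_rw [convPow_univ]
  exact tsum_poisson_weights Q

theorem charFun_compoundPoisson (ξ : ℝ) :
    charFun (compoundPoisson Q) ξ =
      Complex.exp (∫ u, (Complex.exp ((ξ * u : ℝ) * Complex.I) - 1) ∂Q) := by
  have hint : ∀ (μ : Measure ℝ) [IsFiniteMeasure μ],
      Integrable (fun u : ℝ => Complex.exp ((ξ * u : ℝ) * Complex.I)) μ := by
    intro μ _
    refine Integrable.of_bound (by fun_prop) 1 (ae_of_all _ fun u => ?_)
    rw [Complex.norm_exp_ofReal_mul_I]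
  have hQ : ∫ u, (Complex.exp ((ξ * u : ℝ) * Complex.I) - 1) ∂Q
      = charFun Q ξ - (Q.real univ : ℂ) := by
    rw [integral_sub (hint Q) (integrable_const _), charFun_apply_real]
    simp
  have h1 : HasSum (fun n : ℕ => ∫ u, Complex.exp ((ξ * u : ℝ) * Complex.I)
      ∂(ENNReal.ofReal (Real.exp (-Q.real univ) / n.factorial) • convPow Q n))
      (∫ u, Complex.exp ((ξ * u : ℝ) * Complex.I) ∂compoundPoisson Q) :=
    hasSum_integral_measure (hint (compoundPoisson Q))
  have h2 : ∀ n : ℕ, ∫ u, Complex.exp ((ξ * u : ℝ) * Complex.I)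
      ∂(ENNReal.ofReal (Real.exp (-Q.real univ) / n.factorial) • convPow Q n)
      = Complex.exp (-(Q.real univ : ℂ)) * (charFun Q ξ ^ n / n.factorial) := by
    intro n
    rw [integral_smul_measure, ENNReal.toReal_ofReal (by positivity), ← charFun_convPow,
      charFun_apply_real]
    simp only [Complex.real_smul]
    push_cast
    ring
  simp_rw [h2] at h1
  have h3 := (NormedSpace.expSeries_div_hasSum_exp (charFun Q ξ)).mul_left
    (Complex.exp (-(Q.real univ : ℂ)))
  rw [← Complex.exp_eq_exp_ℂ, ← Complex.exp_add] at h3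
  rw [hQ, sub_eq_neg_add, h3.unique h1, charFun_apply_real]
  simp

theorem convPow_mono {Q' : Measure ℝ} [IsFiniteMeasure Q'] (h : Q' ≤ Q) (n : ℕ) :
    convPow Q' n ≤ convPow Q n := by
  induction n with
  | zero => simp [convPow]
  | succ n ih =>
    refine Measure.le_iff.2 fun s hs => ?_
    rw [← lintegral_indicator_one hs, ← lintegral_indicator_one hs,
      lintegral_convPow_succ _ _ (measurable_one.indicator hs),
      lintegral_convPow_succ _ _ (measurable_one.indicator hs)]
    exact lintegral_mono' ih fun u => lintegral_mono' h le_rfl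

theorem convPow_Iio_zero (h0 : Q (Iio 0) = 0) (n : ℕ) : convPow Q n (Iio 0) = 0 := by
  induction n with
  | zero => simp [convPow]
  | succ n ih =>
    rw [← lintegral_indicator_one measurableSet_Iio,
      lintegral_convPow_succ _ _ (measurable_one.indicator measurableSet_Iio)]
    refine (lintegral_eq_zero_iff' ?_).2 ?_
    · exact ((measurable_one.indicator measurableSet_Iio).comp
        measurable_add).lintegral_prod_right'.aemeasurable
    · have h1 : ∀ᵐ u ∂convPow Q n, 0 ≤ u := by
        rw [ae_iff]; simpa [not_le, Iio_def] using ih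
      have h2 : ∀ᵐ u ∂Q, 0 ≤ u := by
        rw [ae_iff]; simpa [not_le, Iio_def] using h0
      filter_upwards [h1] with u hu
      refine lintegral_eq_zero_of_ae_eq_zero ?_
      filter_upwards [h2] with v hv
      simp [add_nonneg hu hv]

theorem compoundPoisson_Iio_zero (h0 : Q (Iio 0) = 0) : compoundPoisson Q (Iio 0) = 0 := by
  rw [compoundPoisson_apply Q measurableSet_Iio]
  simp [convPow_Iio_zero Q h0]

/-- `ENNReal.ofReal` takes the positive part, which is subadditive; hence an inequality, with no
sign condition on `Q`. -/
theorem lintegral_ofReal_convPow_le (n : ℕ) :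
    ∫⁻ u, ENNReal.ofReal u ∂convPow Q (n + 1)
      ≤ (n + 1) * (∫⁻ u, ENNReal.ofReal u ∂Q) * Q univ ^ n := by
  have step : ∀ n, ∫⁻ u, ENNReal.ofReal u ∂convPow Q (n + 1)
      ≤ (∫⁻ u, ENNReal.ofReal u ∂convPow Q n) * Q univ
        + (∫⁻ u, ENNReal.ofReal u ∂Q) * Q univ ^ n := by
    intro n
    rw [lintegral_convPow_succ _ _ ENNReal.measurable_ofReal]
    calc ∫⁻ u, ∫⁻ v, ENNReal.ofReal (u + v) ∂Q ∂convPow Q n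
        ≤ ∫⁻ u, (ENNReal.ofReal u * Q univ + ∫⁻ v, ENNReal.ofReal v ∂Q) ∂convPow Q n := by
          refine lintegral_mono fun u => ?_
          calc ∫⁻ v, ENNReal.ofReal (u + v) ∂Q
              ≤ ∫⁻ v, (ENNReal.ofReal u + ENNReal.ofReal v) ∂Q :=
                lintegral_mono fun v => ENNReal.ofReal_add_le
            _ = _ := by rw [lintegral_add_left measurable_const, lintegral_const]
      _ = _ := by
          rw [lintegral_add_left (by fun_prop), lintegral_const, convPow_univ,
            lintegral_mul_const _ ENNReal.measurable_ofReal]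
  induction n with
  | zero =>
    refine (step 0).trans ?_
    simp [convPow]
  | succ n ih =>
    refine (step (n + 1)).trans ?_
    calc _ ≤ ((n + 1) * (∫⁻ u, ENNReal.ofReal u ∂Q) * Q univ ^ n) * Q univ
        + (∫⁻ u, ENNReal.ofReal u ∂Q) * Q univ ^ (n + 1) := by gcongr
      _ = _ := by push_cast; ring

/-- The factor `n + 1` from the convolution power cancels against `(n + 1)!`, which leaves the
Poisson weights, of total mass one, times the first moment of `Q`. -/
theorem lintegral_ofReal_compoundPoisson_le :
    ∫⁻ u, ENNReal.ofReal u ∂compoundPoisson Q ≤ ∫⁻ u, ENNReal.ofReal u ∂Q := by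
  rw [compoundPoisson, lintegral_sum_measure, tsum_eq_zero_add' ENNReal.summable]
  simp only [lintegral_smul_measure]
  have h0 : ∫⁻ u, ENNReal.ofReal u ∂convPow Q 0 = 0 := by simp [convPow]
  rw [h0, smul_zero, zero_add]
  calc ∑' n : ℕ, ENNReal.ofReal (Real.exp (-Q.real univ) / (n + 1).factorial) •
        ∫⁻ u, ENNReal.ofReal u ∂convPow Q (n + 1)
      ≤ ∑' n : ℕ, (ENNReal.ofReal (Real.exp (-Q.real univ) / n.factorial) * Q univ ^ n)
          * ∫⁻ u, ENNReal.ofReal u ∂Q := by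
        refine ENNReal.tsum_le_tsum fun n => ?_
        rw [smul_eq_mul]
        refine (mul_le_mul_right (lintegral_ofReal_convPow_le Q n) _).trans_eq ?_
        have : ENNReal.ofReal (Real.exp (-Q.real univ) / (n + 1).factorial) * (n + 1)
            = ENNReal.ofReal (Real.exp (-Q.real univ) / n.factorial) := by
          have h : ((n : ℝ≥0∞) + 1) = ENNReal.ofReal (n + 1) := by
            rw [ENNReal.ofReal_add (by positivity) one_pos.le]; simp
          rw [h, ← ENNReal.ofReal_mul (by positivity)]
          congr 1
          rw [Nat.factorial_succ]
          push_cast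
          field_simp
        rw [← this]
        ring
    _ = _ := by rw [ENNReal.tsum_mul_right, tsum_poisson_weights, one_mul]

/-- Discarding the jumps of size at least `ε` costs a factor `exp (-κ)`, and the sum of the others
is controlled by its mean. -/
theorem le_compoundPoisson_Iic {ε κ η : ℝ} (hη : 0 < η)
    (hbig : Q (Ici ε) ≤ ENNReal.ofReal κ) (hκ : 0 ≤ κ)
    (hsmall : ∫⁻ u in Iio ε, ENNReal.ofReal u ∂Q ≤ ENNReal.ofReal (η / 2)) :
    ENNReal.ofReal (Real.exp (-κ) / 2) ≤ compoundPoisson Q (Iic η) := by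
  set R := Q.restrict (Iio ε) with hR
  -- Restricting the jumps lowers every convolution power, while the prefactors `exp(-Q(ℝ))` and
  -- `exp(-R(ℝ))` differ by `exp(-Q([ε, ∞)))`, which is at least `exp(-κ)`.
  have hle : ENNReal.ofReal (Real.exp (-κ)) * compoundPoisson R (Iic η)
      ≤ compoundPoisson Q (Iic η) := by
    rw [compoundPoisson_apply _ measurableSet_Iic, compoundPoisson_apply _ measurableSet_Iic,
      ← ENNReal.tsum_mul_left]
    refine ENNReal.tsum_le_tsum fun n => ?_
    rw [← mul_assoc, ← ENNReal.ofReal_mul (by positivity)]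
    refine mul_le_mul' (ENNReal.ofReal_le_ofReal ?_)
      (convPow_mono Q Measure.restrict_le_self n _)
    rw [← mul_div_assoc, ← Real.exp_add]
    gcongr
    have h1 : Q.real univ = R.real univ + Q.real (Ici ε) := by
      have := measureReal_add_measureReal_compl (μ := Q) (measurableSet_Iio (a := ε))
      rw [compl_Iio] at this
      rw [← this, hR]
      simp
    have h2 : Q.real (Ici ε) ≤ κ := ENNReal.toReal_le_of_le_ofReal hκ hbig
    linarith
  refine le_trans ?_ hle
  -- Markov's inequality: the positive part has mean at most `η / 2`.
  have hm : compoundPoisson R (Ioi η) ≤ ENNReal.ofReal (1 / 2) := by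
    calc compoundPoisson R (Ioi η)
        ≤ compoundPoisson R {u | ENNReal.ofReal η ≤ ENNReal.ofReal u} :=
          measure_mono fun u hu => ENNReal.ofReal_le_ofReal (le_of_lt hu)
      _ ≤ (∫⁻ u, ENNReal.ofReal u ∂compoundPoisson R) / ENNReal.ofReal η :=
          meas_ge_le_lintegral_div ENNReal.measurable_ofReal.aemeasurable (by simpa using hη)
            ENNReal.ofReal_ne_top
      _ ≤ ENNReal.ofReal (η / 2) / ENNReal.ofReal η := by
          gcongr
          exact (lintegral_ofReal_compoundPoisson_le R).trans hsmall
      _ = ENNReal.ofReal (1 / 2) := by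
          rw [← ENNReal.ofReal_div_of_pos hη]
          congr 1
          field_simp
  have hc : ENNReal.ofReal (1 / 2) ≤ compoundPoisson R (Iic η) := by
    rw [← compl_Ioi, prob_compl_eq_one_sub measurableSet_Ioi]
    calc ENNReal.ofReal (1 / 2) = 1 - ENNReal.ofReal (1 / 2) := by
          rw [← ENNReal.ofReal_one, ← ENNReal.ofReal_sub _ (by norm_num)]
          norm_num
      _ ≤ _ := tsub_le_tsub_left hm 1
  calc ENNReal.ofReal (Real.exp (-κ) / 2)
      = ENNReal.ofReal (Real.exp (-κ)) * ENNReal.ofReal (1 / 2) := by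
        rw [← ENNReal.ofReal_mul (by positivity)]
        congr 1
        ring
    _ ≤ _ := mul_le_mul_right hc _

end CompoundPoisson

/-! ### Laws with a one-sided Lévy measure -/

theorem norm_exp_mul_I_sub_one_le (ξ u : ℝ) :
    ‖Complex.exp ((ξ * u : ℝ) * Complex.I) - 1‖ ≤ (2 + |ξ|) * min |u| 1 := by
  have h1 : ‖Complex.exp ((ξ * u : ℝ) * Complex.I) - 1‖ ≤ 2 := by
    refine (norm_sub_le _ _).trans ?_
    rw [Complex.norm_exp_ofReal_mul_I, norm_one]
    norm_num
  have h2 : ‖Complex.exp ((ξ * u : ℝ) * Complex.I) - 1‖ ≤ |ξ| * |u| := by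
    rw [mul_comm _ Complex.I, ← abs_mul]
    exact Real.norm_exp_I_mul_ofReal_sub_one_le
  rcases le_total |u| 1 with h | h
  · rw [min_eq_left h]
    nlinarith [abs_nonneg ξ, abs_nonneg u]
  · rw [min_eq_right h]
    linarith [abs_nonneg ξ]

theorem integrable_exp_mul_I_sub_one {Q : Measure ℝ} (hint : Integrable (fun u => min |u| 1) Q)
    (ξ : ℝ) : Integrable (fun u : ℝ => Complex.exp ((ξ * u : ℝ) * Complex.I) - 1) Q :=
  (hint.const_mul (2 + |ξ|)).mono' (by fun_prop)
    (ae_of_all _ fun u => norm_exp_mul_I_sub_one_le ξ u)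

section OneSided

variable {Q : Measure ℝ} (hint : Integrable (fun u => min |u| 1) Q)

include hint in
theorem isFiniteMeasure_restrict_Ioi (n : ℕ) :
    IsFiniteMeasure (Q.restrict (Ioi (1 / ((n : ℝ) + 1)))) := by
  refine isFiniteMeasure_restrict.2 (lt_of_le_of_lt (measure_mono ?_)
    (hint.measure_ge_lt_top (ε := 1 / ((n : ℝ) + 1)) (by positivity))).ne
  intro u hu
  have h1 : 1 / ((n : ℝ) + 1) ≤ 1 := by
    rw [div_le_one (by positivity)]
    linarith [n.cast_nonneg (α := ℝ)]
  exact le_min ((le_of_lt hu).trans (le_abs_self u)) h1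

variable (h0 : Q (Iio 0) = 0) {ν : Measure ℝ} [IsProbabilityMeasure ν]
  (hν : ∀ ξ, charFun ν ξ =
    Complex.exp (∫ u, (Complex.exp ((ξ * u : ℝ) * Complex.I) - 1) ∂Q))

-- The compound Poisson laws of the jumps exceeding `1 / (n + 1)` converge weakly to `ν` by Lévy's
-- continuity theorem, and on closed sets weak limits preserve lower bounds (portmanteau). Facts
-- about finite jump measures thus pass to infinite ones.
include hint h0 hν in
theorem le_measure_of_le_compoundPoisson {F : Set ℝ} (hF : IsClosed F) {c : ℝ≥0∞}
    (h : ∀ n : ℕ, c ≤ compoundPoisson (Q.restrict (Ioi (1 / ((n : ℝ) + 1)))) F) : c ≤ ν F := by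
  have hfin := isFiniteMeasure_restrict_Ioi hint
  have hunion : ⋃ n : ℕ, Ioi (1 / ((n : ℝ) + 1)) = Ioi 0 := by
    ext u
    simp only [mem_iUnion, mem_Ioi]
    exact ⟨fun ⟨n, hn⟩ => lt_trans (by positivity) hn, exists_nat_one_div_lt⟩
  let μs : ℕ → ProbabilityMeasure ℝ := fun n =>
    ⟨compoundPoisson (Q.restrict (Ioi (1 / ((n : ℝ) + 1)))),
      isProbabilityMeasure_compoundPoisson _⟩
  let μ₀ : ProbabilityMeasure ℝ := ⟨ν, inferInstance⟩
  have hlim : Tendsto μs atTop (𝓝 μ₀) := by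
    refine ProbabilityMeasure.tendsto_of_tendsto_charFun fun ξ => ?_
    simp only [μs, μ₀, ProbabilityMeasure.coe_mk, charFun_compoundPoisson, hν]
    refine (Complex.continuous_exp.tendsto _).comp ?_
    have := tendsto_setIntegral_of_monotone (μ := Q) (s := fun n : ℕ => Ioi (1 / ((n : ℝ) + 1)))
      (fun n => measurableSet_Ioi)
      (fun m n hmn => Ioi_subset_Ioi (one_div_le_one_div_of_le (by positivity) (by gcongr)))
      (integrable_exp_mul_I_sub_one hint ξ).integrableOn
    -- Passing from `(0, ∞)` to the whole line is free: negative jumps are null and the integrand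
    -- vanishes at `0`.
    rw [hunion, setIntegral_eq_integral_of_ae_compl_eq_zero] at this
    · exact this
    · have h0' : ∀ᵐ u ∂Q, 0 ≤ u := by
        rw [ae_iff]
        simpa [not_le, Iio_def] using h0
      filter_upwards [h0'] with u hu hu'
      rw [le_antisymm (not_lt.1 hu') hu]
      simp
  refine le_trans ?_ (ProbabilityMeasure.limsup_measure_closed_le_of_tendsto hlim hF)
  exact le_limsup_of_frequently_le (Frequently.of_forall h) (by isBoundedDefault)

include hint h0 hν in
theorem measure_Iio_zero_of_charFun : ν (Iio 0) = 0 := by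
  rw [← compl_Ici, prob_compl_eq_zero_iff measurableSet_Ici]
  refine le_antisymm prob_le_one (le_measure_of_le_compoundPoisson hint h0 hν isClosed_Ici ?_)
  intro n
  have hfin := isFiniteMeasure_restrict_Ioi hint n
  refine ((prob_compl_eq_zero_iff measurableSet_Ici).1 ?_).ge
  rw [compl_Ici]
  refine compoundPoisson_Iio_zero _ (le_antisymm ?_ bot_le)
  exact (Measure.restrict_apply_le _ _).trans h0.le

include hint h0 hν in
theorem le_measure_Iic_of_charFun {ε κ η : ℝ} (hη : 0 < η)
    (hbig : Q (Ici ε) ≤ ENNReal.ofReal κ) (hκ : 0 ≤ κ)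
    (hsmall : ∫⁻ u in Iio ε, ENNReal.ofReal u ∂Q ≤ ENNReal.ofReal (η / 2)) :
    ENNReal.ofReal (Real.exp (-κ) / 2) ≤ ν (Iic η) := by
  refine le_measure_of_le_compoundPoisson hint h0 hν isClosed_Iic fun n => ?_
  have hfin := isFiniteMeasure_restrict_Ioi hint n
  refine le_compoundPoisson_Iic _ hη ((Measure.restrict_apply_le _ _).trans hbig) hκ ?_
  exact (lintegral_mono' (Measure.restrict_mono subset_rfl Measure.restrict_le_self)
    le_rfl).trans hsmall

end OneSided

/-! ### Pathwise comparison -/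

/-- Grönwall's inequality in integral form, for an integrable function. -/
theorem le_mul_exp_of_le_add_mul_integral {w : ℝ → ℝ} {t K δ : ℝ} (ht : 0 ≤ t) (hK : 0 ≤ K)
    (hw : IntervalIntegrable w volume 0 t)
    (h : ∀ s ∈ Icc 0 t, w s ≤ δ + K * ∫ r in (0 : ℝ)..s, w r) :
    w t ≤ δ * Real.exp (K * t) := by
  set W : ℝ → ℝ := fun s => δ + K * ∫ r in (0 : ℝ)..s, w r with hW
  have hWc : ContinuousOn W (Icc 0 t) := by
    have := intervalIntegral.continuousOn_primitive_interval (μ := volume) (f := w) (a := 0)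
      (b := t) ((intervalIntegrable_iff' (by simp)).1 hw)
    rw [uIcc_of_le ht] at this
    exact continuousOn_const.add (continuousOn_const.mul this)
  have hWi : IntervalIntegrable W volume 0 t := by
    refine ContinuousOn.intervalIntegrable ?_
    rwa [uIcc_of_le ht]
  have hsub : ∀ s ∈ Icc 0 t, uIcc 0 s ⊆ uIcc 0 t := by
    intro s hs
    rw [uIcc_of_le hs.1, uIcc_of_le ht]
    exact Icc_subset_Icc_right hs.2
  -- As `w` is merely integrable, `W` is continuous but perhaps not differentiable. One more
  -- integration gives `V` with `V' = K W ≤ K V`, so that `V exp(-K s)` is nonincreasing.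
  set V : ℝ → ℝ := fun s => δ + K * ∫ r in (0 : ℝ)..s, W r with hV
  have hWV : ∀ s ∈ Icc 0 t, W s ≤ V s := by
    intro s hs
    simp only [hW, hV]
    gcongr
    refine intervalIntegral.integral_mono_on hs.1 (hw.mono_set (hsub s hs))
      (hWi.mono_set (hsub s hs)) fun r hr => h r ⟨hr.1, hr.2.trans hs.2⟩
  have hVc : ContinuousOn V (Icc 0 t) := by
    have := intervalIntegral.continuousOn_primitive_interval (μ := volume) (f := W) (a := 0)
      (b := t) ((intervalIntegrable_iff' (by simp)).1 hWi)
    rw [uIcc_of_le ht] at this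
    exact continuousOn_const.add (continuousOn_const.mul this)
  have hVd : ∀ s ∈ Ioo 0 t, HasDerivAt V (K * W s) s := by
    intro s hs
    have hs' : s ∈ Icc 0 t := Ioo_subset_Icc_self hs
    refine (HasDerivAt.const_mul K (intervalIntegral.integral_hasDerivAt_right
      (hWi.mono_set (hsub s hs')) ?_ (hWc.continuousAt (Icc_mem_nhds hs.1 hs.2)))).const_add δ
    exact (hWc.mono Ioo_subset_Icc_self).stronglyMeasurableAtFilter isOpen_Ioo s hs
  have hG : AntitoneOn (fun s => V s * Real.exp (-(K * s))) (Icc 0 t) := by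
    refine antitoneOn_of_hasDerivWithinAt_nonpos (convex_Icc 0 t) (hVc.mul (by fun_prop))
      (f' := fun s => K * W s * Real.exp (-(K * s)) + V s * (Real.exp (-(K * s)) * (-(K * 1))))
      ?_ ?_
    · intro s hs
      rw [interior_Icc] at hs ⊢
      exact ((hVd s hs).mul (((hasDerivAt_id s).const_mul K).neg.exp)).hasDerivWithinAt
    · intro s hs
      rw [interior_Icc] at hs
      have h1 := mul_nonneg (mul_nonneg hK (Real.exp_nonneg (-(K * s))))
        (sub_nonneg.2 (hWV s (Ioo_subset_Icc_self hs)))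
      linarith
  have h2 := hG (left_mem_Icc.2 ht) (right_mem_Icc.2 ht) ht
  have h0 : V 0 = δ := by simp [hV]
  simp only [h0, mul_zero, neg_zero, Real.exp_zero, mul_one] at h2
  rw [Real.exp_neg, ← div_eq_mul_inv, div_le_iff₀ (Real.exp_pos _)] at h2
  exact ((h t (right_mem_Icc.2 ht)).trans (hWV t (right_mem_Icc.2 ht))).trans h2

/-- While `z` is positive, the drift `h` is at most `K z` and `S₂` only pushes down. Following `z`
from its last nonpositive time shows that the positive part of `z` satisfies Grönwall's inequality
with constant `S₁ t`. -/
theorem le_mul_exp_of_monotone_forcing {z h S₁ S₂ : ℝ → ℝ} {t K : ℝ} (ht : 0 ≤ t) (hK : 0 ≤ K)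
    (hh : IntervalIntegrable h volume 0 t)
    (hz : ∀ s ∈ Icc 0 t, z s = (∫ r in (0 : ℝ)..s, h r) + S₁ s - S₂ s)
    (hhz : ∀ s ∈ Icc 0 t, |h s| ≤ K * |z s|)
    (hS₁ : MonotoneOn S₁ (Icc 0 t)) (hS₂ : MonotoneOn S₂ (Icc 0 t))
    (hS₁0 : S₁ 0 = 0) (hS₂0 : S₂ 0 = 0) :
    z t ≤ S₁ t * Real.exp (K * t) := by
  set H : ℝ → ℝ := fun s => ∫ r in (0 : ℝ)..s, h r with hH
  have hsub : ∀ r ∈ Icc 0 t, ∀ s ∈ Icc 0 t, uIcc r s ⊆ uIcc 0 t := by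
    intro r hr s hs
    rw [uIcc_of_le ht]
    exact uIcc_subset_Icc hr hs
  have hHc : ContinuousOn H (Icc 0 t) := by
    have := intervalIntegral.continuousOn_primitive_interval (μ := volume) (f := h) (a := 0)
      (b := t) ((intervalIntegrable_iff' (by simp)).1 hh)
    rwa [uIcc_of_le ht] at this
  have hzi : IntervalIntegrable z volume 0 t := by
    have h1 : IntervalIntegrable (fun s => H s + S₁ s - S₂ s) volume 0 t := by
      refine (IntervalIntegrable.add ?_ ?_).sub ?_
      · exact ContinuousOn.intervalIntegrable (by rwa [uIcc_of_le ht])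
      · exact MonotoneOn.intervalIntegrable (by rwa [uIcc_of_le ht])
      · exact MonotoneOn.intervalIntegrable (by rwa [uIcc_of_le ht])
    refine h1.congr fun s hs => ?_
    rw [uIoc_of_le ht] at hs
    exact (hz s (Ioc_subset_Icc_self hs)).symm
  set w : ℝ → ℝ := fun s => max (z s) 0 with hw
  have hwi : IntervalIntegrable w volume 0 t := by
    rw [intervalIntegrable_iff] at hzi ⊢
    exact hzi.pos_part
  have hwn : ∀ s, 0 ≤ w s := fun s => le_max_right _ _
  have ht0 : (0 : ℝ) ∈ Icc 0 t := left_mem_Icc.2 ht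
  have htt : t ∈ Icc 0 t := right_mem_Icc.2 ht
  have hS₁n : ∀ s ∈ Icc 0 t, 0 ≤ S₁ s := fun s hs => hS₁0 ▸ hS₁ ht0 hs hs.1
  refine (le_max_left (z t) 0).trans (le_mul_exp_of_le_add_mul_integral ht hK hwi ?_)
  intro s hs
  have hwint : 0 ≤ ∫ r in (0 : ℝ)..s, w r :=
    intervalIntegral.integral_nonneg hs.1 fun r _ => hwn r
  rcases le_or_gt (z s) 0 with hzs | hzs
  · rw [hw]
    simp only [max_eq_right hzs]
    have := hS₁n t htt
    positivity
  set A : Set ℝ := {r | r ∈ Icc 0 s ∧ z r ≤ 0} with hA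
  have hA0 : (0 : ℝ) ∈ A := by
    refine ⟨left_mem_Icc.2 hs.1, ?_⟩
    rw [hz 0 ht0]
    simp [hS₁0, hS₂0]
  have hst : Icc 0 s ⊆ Icc 0 t := Icc_subset_Icc_right hs.2
  have hAb : BddAbove A := ⟨s, fun r hr => hr.1.2⟩
  set τ := sSup A with hτ
  -- `z` may jump, so `z τ ≤ 0` can fail at `τ = sSup A`. The consequence recorded here involves
  -- only the continuous `H`, defines a closed set, and so survives at `τ`.
  have hAs : A ⊆ {r | r ∈ Icc 0 s ∧ H r ≤ H s + S₁ t - z s} := by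
    intro r hr
    refine ⟨hr.1, ?_⟩
    have e1 := hz s hs
    have e2 := hz r (hst hr.1)
    have e3 := hr.2
    have e4 := hS₂ (hst hr.1) hs hr.1.2
    have e5 := hS₁n r (hst hr.1)
    have e6 := hS₁ hs htt hs.2
    simp only [hH]
    linarith
  have hcl : IsClosed {r | r ∈ Icc 0 s ∧ H r ≤ H s + S₁ t - z s} :=
    (hHc.mono hst).preimage_isClosed_of_isClosed isClosed_Icc isClosed_Iic
  obtain ⟨hτs, hτH⟩ := closure_minimal hAs hcl (csSup_mem_closure ⟨0, hA0⟩ hAb)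
  have hτt := hst hτs
  have hpos : ∀ r ∈ Ioc τ s, 0 < z r := by
    intro r hr
    by_contra hneg
    exact absurd (le_csSup hAb ⟨⟨hτs.1.trans hr.1.le, hr.2⟩, not_lt.1 hneg⟩) (not_le.2 hr.1)
  have hHdiff : H s - H τ = ∫ r in τ..s, h r :=
    intervalIntegral.integral_interval_sub_left (hh.mono_set (hsub 0 ht0 s hs))
      (hh.mono_set (hsub 0 ht0 τ hτt))
  have hle : ∫ r in τ..s, h r ≤ ∫ r in τ..s, K * w r := by
    refine intervalIntegral.integral_mono_on_of_le_Ioo hτs.2 (hh.mono_set (hsub τ hτt s hs))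
      ((hwi.mono_set (hsub τ hτt s hs)).const_mul K) fun r hr => ?_
    have hp := hpos r (Ioo_subset_Ioc_self hr)
    refine (le_abs_self _).trans ((hhz r ⟨hτs.1.trans hr.1.le, hr.2.le.trans hs.2⟩).trans_eq ?_)
    rw [abs_of_pos hp, hw]
    simp only [max_eq_left hp.le]
  have hsplit : ∫ r in τ..s, w r ≤ ∫ r in (0 : ℝ)..s, w r := by
    rw [← intervalIntegral.integral_add_adjacent_intervals (hwi.mono_set (hsub 0 ht0 τ hτt))
      (hwi.mono_set (hsub τ hτt s hs))]
    have : 0 ≤ ∫ r in (0 : ℝ)..τ, w r :=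
      intervalIntegral.integral_nonneg hτs.1 fun r _ => hwn r
    linarith
  rw [intervalIntegral.integral_const_mul] at hle
  have h3 := mul_le_mul_of_nonneg_left hsplit hK
  have h4 : w s = z s := max_eq_left hzs.le
  have h5 : H τ ≤ H s + S₁ t - z s := hτH
  rw [h4]
  linarith

/-! ### Boundary behaviour of densities with a bounded weak derivative -/

theorem exists_iteratedDeriv_eq_of_eq_zero_right (k : ℕ) (b : ℝ) (f : ℝ → ℝ)
    (hf : ContDiff ℝ (⊤ : ℕ∞) f) (hf0 : ∀ y, b ≤ y → f y = 0) :
    ∃ F : ℝ → ℝ, ContDiff ℝ (⊤ : ℕ∞) F ∧ (∀ y, b ≤ y → F y = 0) ∧ iteratedDeriv k F = f := by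
  induction k with
  | zero => exact ⟨f, hf, hf0, by simp⟩
  | succ k ih =>
    obtain ⟨G, hG, hG0, hGf⟩ := ih
    have hd : ∀ y, HasDerivAt (fun y => ∫ s in b..y, G s) (G y) y := fun y =>
      intervalIntegral.integral_hasDerivAt_right (hG.continuous.intervalIntegrable _ _)
        (hG.continuous.stronglyMeasurableAtFilter _ _) hG.continuous.continuousAt
    have hderiv : deriv (fun y => ∫ s in b..y, G s) = G := funext fun y => (hd y).deriv
    refine ⟨fun y => ∫ s in b..y, G s, ?_, ?_, ?_⟩
    · rw [contDiff_infty_iff_deriv, hderiv]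
      exact ⟨fun y => (hd y).differentiableAt, hG⟩
    · intro y hy
      change ∫ s in b..y, G s = 0
      rw [intervalIntegral.integral_congr (g := fun _ => (0 : ℝ)), intervalIntegral.integral_zero]
      intro s hs
      rw [uIcc_of_le hy] at hs
      exact hG0 s hs.1
    · rw [iteratedDeriv_succ', hderiv, hGf]

/-- For `k ≥ 1` the `k`-th derivative of a nonzero test function must change sign, but the sign
matters only on `[0, ∞)`, where the density lives. Take a `k`-fold primitive, zero beyond `2`, of a
cutoff equal to `1` up to `1`, and truncate it left of `-1`. -/
theorem exists_test_function (k : ℕ) :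
    ∃ Φ : ℝ → ℝ, ContDiff ℝ (⊤ : ℕ∞) Φ ∧ HasCompactSupport Φ ∧
      (∀ y ∈ Icc (0 : ℝ) 1, 1 ≤ iteratedDeriv k Φ y) ∧ ∀ y, 0 ≤ y → 0 ≤ iteratedDeriv k Φ y := by
  obtain ⟨F, hF, hF0, hFk⟩ := exists_iteratedDeriv_eq_of_eq_zero_right k 2
    (fun y => Real.smoothTransition (2 - y))
    (Real.smoothTransition.contDiff.comp (contDiff_const.sub contDiff_id))
    (fun y hy => Real.smoothTransition.zero_of_nonpos (by linarith))
  set Φ : ℝ → ℝ := fun y => Real.smoothTransition (y + 2) * F y with hΦ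
  have hev : ∀ y, 0 ≤ y → iteratedDeriv k Φ y = Real.smoothTransition (2 - y) := by
    intro y hy
    have : Φ =ᶠ[𝓝 y] F := by
      filter_upwards [Ioi_mem_nhds (show (-1 : ℝ) < y by linarith)] with u hu
      have hu' : (-1 : ℝ) < u := hu
      simp only [hΦ]
      rw [Real.smoothTransition.one_of_one_le (by linarith), one_mul]
    rw [this.iteratedDeriv_eq, hFk]
  refine ⟨Φ, ?_, ?_, ?_, ?_⟩
  · exact (Real.smoothTransition.contDiff.comp (contDiff_id.add contDiff_const)).mul hF
  · refine HasCompactSupport.intro (isCompact_Icc (a := -2) (b := 2)) fun y hy => ?_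
    simp only [hΦ]
    rw [mem_Icc, not_and_or, not_le, not_le] at hy
    rcases hy with hy | hy
    · rw [Real.smoothTransition.zero_of_nonpos (by linarith), zero_mul]
    · rw [hF0 y hy.le, mul_zero]
  · intro y hy
    rw [hev y hy.1, Real.smoothTransition.one_of_one_le (by linarith [hy.2])]
  · intro y hy
    rw [hev y hy]
    exact Real.smoothTransition.nonneg _

theorem hasCompactSupport_iteratedDeriv {f : ℝ → ℝ} (hf : HasCompactSupport f) (k : ℕ) :
    HasCompactSupport (iteratedDeriv k f) := by
  induction k with
  | zero => simpa using hf
  | succ k ih =>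
    rw [iteratedDeriv_succ]
    exact ih.deriv

/-- If a nonnegative `p` of class `CB^k` vanishes on one side of `z`, then its integral over the
adjacent interval of length `|c|⁻¹` is `O(|c|^{-(k+1)})`. -/
theorem setIntegral_le_of_memCB {k : ℕ} {p : ℝ → ℝ} (h : MemCB k p) (hp : ∀ᵐ y, 0 ≤ p y) :
    ∃ C : ℝ, 0 ≤ C ∧ ∀ c z : ℝ, c ≠ 0 → (∀ᵐ y, c * (y - z) < 0 → p y = 0) →
      ∫ y in {y | c * (y - z) ∈ Icc 0 1}, p y ≤ C * |c|⁻¹ ^ (k + 1) := by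
  obtain ⟨D, hD, hDk⟩ := h
  obtain ⟨hpl, -, hweak⟩ := hD k le_rfl
  obtain ⟨M, hM⟩ : ∃ M : ℝ, ∀ᵐ y, ‖D k y‖ ≤ M := by
    refine ⟨(eLpNormEssSup (D k) volume).toReal, ?_⟩
    have h2 : eLpNormEssSup (D k) volume ≠ ∞ := by
      simpa using hDk.2.ne
    filter_upwards [ae_le_eLpNormEssSup (f := D k) (μ := volume)] with y hy
    rw [← toReal_enorm]
    exact ENNReal.toReal_mono h2 hy
  have hM0 : 0 ≤ M := by
    obtain ⟨y, hy⟩ := hM.exists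
    exact (norm_nonneg _).trans hy
  obtain ⟨Φ, hΦ, hΦc, hΦ1, hΦ0⟩ := exists_test_function k
  refine ⟨M * ∫ y, ‖Φ y‖, mul_nonneg hM0 (integral_nonneg fun y => norm_nonneg _), ?_⟩
  intro c z hc hz
  -- The sign of `c` selects the side of `z`, and `|c|⁻¹` is the length scale. The factor `c⁻¹ ^ k`
  -- normalizes the `k`-th derivative; the change of variables in the `L¹` norm supplies the last
  -- power of `|c|⁻¹`.
  set φ : ℝ → ℝ := fun y => (c⁻¹) ^ k * Φ (c * (y - z)) with hφ
  have hφs : ContDiff ℝ (⊤ : ℕ∞) φ :=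
    contDiff_const.mul (hΦ.comp (contDiff_const.mul (contDiff_id.sub contDiff_const)))
  have hφc : HasCompactSupport φ := by
    refine HasCompactSupport.mul_left ?_
    exact hΦc.comp_homeomorph ((Homeomorph.subRight z).trans (Homeomorph.mulLeft₀ c hc))
  have hφk : ∀ y, iteratedDeriv k φ y = iteratedDeriv k Φ (c * (y - z)) := by
    intro y
    have e1 : iteratedDeriv k φ y
        = (c⁻¹) ^ k * iteratedDeriv k (fun y => Φ (c * (y - z))) y :=
      iteratedDeriv_const_mul_field _ _
    have e2 := congrFun (iteratedDeriv_comp_sub_const k (fun y => Φ (c * y)) z) y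
    have e3 := iteratedDeriv_comp_const_mul (hΦ.of_le (by exact_mod_cast le_top) :
      ContDiff ℝ k Φ) c
    rw [e1, e2, e3]
    simp only
    rw [← mul_assoc, ← mul_pow, inv_mul_cancel₀ hc, one_pow, one_mul]
  have hk_cont : Continuous (iteratedDeriv k φ) :=
    hφs.continuous_iteratedDeriv k (by exact_mod_cast le_top)
  have hk_supp : HasCompactSupport (iteratedDeriv k φ) := hasCompactSupport_iteratedDeriv hφc k
  have hint : Integrable (fun y => p y * iteratedDeriv k φ y) := by
    simpa [mul_comm] using
      hpl.integrable_smul_left_of_hasCompactSupport hk_cont hk_supp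
  have hmeas : MeasurableSet {y | c * (y - z) ∈ Icc (0 : ℝ) 1} :=
    (by fun_prop : Measurable fun y => c * (y - z)) measurableSet_Icc
  have hmul : ∀ᵐ y, 0 ≤ p y * iteratedDeriv k φ y := by
    filter_upwards [hp, hz] with y hy hzy
    rw [hφk]
    rcases lt_or_ge (c * (y - z)) 0 with h' | h'
    · rw [hzy h', zero_mul]
    · exact mul_nonneg hy (hΦ0 _ h')
  have hΦint : Integrable (fun y => ‖Φ y‖) :=
    (hΦ.continuous.integrable_of_hasCompactSupport hΦc).norm
  calc ∫ y in {y | c * (y - z) ∈ Icc 0 1}, p y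
      ≤ ∫ y, p y * iteratedDeriv k φ y := by
        rw [← integral_indicator hmeas]
        refine integral_mono_of_nonneg ?_ hint ?_
        · filter_upwards [hp] with y hy
          exact indicator_apply_nonneg fun _ => hy
        · filter_upwards [hp, hmul] with y hy hmy
          by_cases hys : c * (y - z) ∈ Icc (0 : ℝ) 1
          · rw [indicator_of_mem (show y ∈ {y | c * (y - z) ∈ Icc (0 : ℝ) 1} from hys), hφk]
            exact le_mul_of_one_le_right hy (hΦ1 _ hys)
          · rwa [indicator_of_notMem (show y ∉ {y | c * (y - z) ∈ Icc (0 : ℝ) 1} from hys)]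
    _ = (-1) ^ k * ∫ y, D k y * φ y := hweak φ hφs hφc
    _ ≤ ‖(-1) ^ k * ∫ y, D k y * φ y‖ := Real.le_norm_self _
    _ = ‖∫ y, D k y * φ y‖ := by simp
    _ ≤ ∫ y, M * (|c|⁻¹ ^ k * ‖Φ (c * (y - z))‖) := by
        refine norm_integral_le_of_norm_le ?_ ?_
        · refine Integrable.const_mul (Integrable.const_mul ?_ _) _
          exact (hΦint.comp_mul_left' hc).comp_sub_right z
        · filter_upwards [hM] with y hy
          rw [norm_mul]
          refine mul_le_mul hy (le_of_eq ?_) (norm_nonneg _) hM0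
          rw [hφ]
          simp
    _ = M * (∫ y, ‖Φ y‖) * |c|⁻¹ ^ (k + 1) := by
        rw [integral_const_mul, integral_const_mul,
          integral_sub_right_eq_self (fun y => ‖Φ (c * y)‖) z,
          Measure.integral_comp_mul_left (fun y => ‖Φ y‖) c, smul_eq_mul, abs_inv]
        ring

theorem measure_le_of_memCB {k : ℕ} {p : ℝ → ℝ} {μ : Measure ℝ} [IsFiniteMeasure μ]
    (hp : IsLebesgueDensity p μ) (h : MemCB k p) :
    ∃ C : ℝ, 0 ≤ C ∧ ∀ c z : ℝ, c ≠ 0 → μ {y | c * (y - z) < 0} = 0 →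
      μ {y | c * (y - z) ≤ 1} ≤ ENNReal.ofReal (C * |c|⁻¹ ^ (k + 1)) := by
  obtain ⟨C, hC, hb⟩ := setIntegral_le_of_memCB h hp.nonneg
  refine ⟨C, hC, fun c z hc hz => ?_⟩
  have hm : Measurable fun y => c * (y - z) := by fun_prop
  have hm0 : MeasurableSet {y | c * (y - z) < 0} := hm measurableSet_Iio
  have hm1 : MeasurableSet {y | c * (y - z) ∈ Icc 0 1} := hm measurableSet_Icc
  have hint : Integrable p := by
    rw [← lintegral_ofReal_ne_top_iff_integrable hp.aemeasurable.aestronglyMeasurable hp.nonneg,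
      ← setLIntegral_univ, ← withDensity_apply _ MeasurableSet.univ, ← hp.eq_withDensity]
    exact measure_ne_top μ univ
  have hzero : ∀ᵐ y, c * (y - z) < 0 → p y = 0 := by
    rw [hp.eq_withDensity, withDensity_apply _ hm0,
      lintegral_eq_zero_iff' hp.aemeasurable.ennreal_ofReal.restrict, EventuallyEq,
      ae_restrict_iff' hm0] at hz
    filter_upwards [hz, hp.nonneg] with y hy hy0 hlt
    exact le_antisymm (ENNReal.ofReal_eq_zero.1 (hy hlt)) hy0
  calc μ {y | c * (y - z) ≤ 1}
      ≤ μ ({y | c * (y - z) < 0} ∪ {y | c * (y - z) ∈ Icc 0 1}) := by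
        refine measure_mono fun y hy => ?_
        rcases lt_or_ge (c * (y - z)) 0 with h' | h'
        · exact Or.inl h'
        · exact Or.inr ⟨h', hy⟩
    _ ≤ μ {y | c * (y - z) ∈ Icc 0 1} := by
        refine (measure_union_le _ _).trans ?_
        rw [hz, zero_add]
    _ = ENNReal.ofReal (∫ y in {y | c * (y - z) ∈ Icc 0 1}, p y) := by
        rw [hp.eq_withDensity, withDensity_apply _ hm1,
          ofReal_integral_eq_lintegral_ofReal hint.integrableOn (ae_restrict_of_ae hp.nonneg)]
    _ ≤ _ := ENNReal.ofReal_le_ofReal (hb c z hc hzero)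

/-! ### The monotone part of a Lévy process of bounded variation with one-sided jumps -/

/-- The compensator `∫_{|u| ≤ 1} u Π(du)` of the small jumps. -/
noncomputable def smallJumpDrift (Pi : Measure ℝ) : ℝ := ∫ u in {u | |u| ≤ 1}, u ∂Pi

/-- Integrability of `min(|u|, 1)` lets the compensating term be integrated separately; it becomes a
pure drift. -/
theorem levyExponent_eq {Pi : Measure ℝ} (hint : Integrable (fun u => min |u| 1) Pi) (ξ : ℝ) :
    levyExponent Pi ξ = (∫ u, (Complex.exp ((ξ * u : ℝ) * Complex.I) - 1) ∂Pi)
      - ((ξ * smallJumpDrift Pi : ℝ) : ℂ) * Complex.I := by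
  have hm : MeasurableSet {u : ℝ | |u| ≤ 1} := measurableSet_le (by fun_prop) (by fun_prop)
  have hfun : (fun u : ℝ => if |u| ≤ 1 then ((ξ * u : ℝ) : ℂ) * Complex.I else 0)
      = indicator {u : ℝ | |u| ≤ 1} (fun u => ((ξ * u : ℝ) : ℂ) * Complex.I) := by
    ext u
    simp [indicator_apply]
  have hi : IntegrableOn (fun u : ℝ => u) {u : ℝ | |u| ≤ 1} Pi := by
    refine Integrable.mono' hint.integrableOn (by fun_prop) ?_
    refine (ae_restrict_iff' hm).2 (ae_of_all _ fun u hu => ?_)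
    rw [Real.norm_eq_abs, min_eq_left hu]
  have hi2 : IntegrableOn (fun u : ℝ => ((ξ * u : ℝ) : ℂ) * Complex.I) {u : ℝ | |u| ≤ 1} Pi :=
    (Integrable.ofReal (hi.const_mul ξ)).mul_const _
  rw [levyExponent, integral_sub (integrable_exp_mul_I_sub_one hint ξ), hfun,
    integral_indicator hm, integral_mul_const, integral_complex_ofReal, integral_const_mul]
  · rfl
  · rw [hfun, integrable_indicator_iff hm]
    exact hi2

section MonotonePart

variable {Ω : Type*} [MeasurableSpace Ω] {P : Measure Ω} [IsProbabilityMeasure P]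
  {Pi : Measure ℝ} {U : ℝ≥0 → Ω → ℝ} {σ : ℝ}

/-- `U` with the compensator of the small jumps removed, oriented by the sign `σ`. -/
noncomputable def monotonePart (Pi : Measure ℝ) (U : ℝ≥0 → Ω → ℝ) (σ : ℝ) (t : ℝ≥0) (ω : Ω) : ℝ :=
  σ * (U t ω + smallJumpDrift Pi * t)

/-- The Lévy measure of the increment of `monotonePart` over `[s, t]`. -/
noncomputable def incrementLevyMeasure (Pi : Measure ℝ) (σ : ℝ) (s t : ℝ≥0) : Measure ℝ :=
  (t - s) • Pi.map (σ * ·)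

omit [IsProbabilityMeasure P] in
theorem IsPureJumpLevyProcess.aemeasurable_monotonePart (hU : IsPureJumpLevyProcess U Pi P)
    (t : ℝ≥0) : AEMeasurable (monotonePart Pi U σ t) P :=
  ((hU.aemeasurable t).add_const _).const_mul σ

omit [IsProbabilityMeasure P] in
theorem IsPureJumpLevyProcess.charFun_monotonePart_sub (hU : IsPureJumpLevyProcess U Pi P)
    (hint : Integrable (fun u => min |u| 1) Pi) {s t : ℝ≥0} (hst : s ≤ t) (ξ : ℝ) :
    charFun (P.map (monotonePart Pi U σ t - monotonePart Pi U σ s)) ξ =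
      Complex.exp (∫ u, (Complex.exp ((ξ * u : ℝ) * Complex.I) - 1)
        ∂incrementLevyMeasure Pi σ s t) := by
  have hsub : AEMeasurable (U t - U s) P := (hU.aemeasurable t).sub (hU.aemeasurable s)
  set d : ℝ := smallJumpDrift Pi * ((t : ℝ) - s)
  have h1 : monotonePart Pi U σ t - monotonePart Pi U σ s
      = fun ω => σ * ((U t - U s) ω + d) := by
    ext ω
    simp only [monotonePart, _root_.Pi.sub_apply, d]
    ring
  have h2 : P.map (fun ω => (U t - U s) ω + d) = (P.map (U t - U s)).map (· + d) :=
    (AEMeasurable.map_map_of_aemeasurable (g := (· + d)) (by fun_prop) hsub).symm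
  have h3 : ∫ u, (Complex.exp ((ξ * u : ℝ) * Complex.I) - 1) ∂incrementLevyMeasure Pi σ s t
      = ((t : ℝ) - (s : ℝ) : ℝ) *
        ∫ u, (Complex.exp ((σ * ξ * u : ℝ) * Complex.I) - 1) ∂Pi := by
    rw [incrementLevyMeasure, integral_smul_nnreal_measure,
      integral_map (by fun_prop) (by fun_prop), NNReal.smul_def, NNReal.coe_sub hst,
      Complex.real_smul]
    congr 2
    ext u
    rw [show ξ * (σ * u) = σ * ξ * u by ring]
  rw [h1, charFun_map_mul_comp (hsub.add_const d), h2, charFun_map_add_const,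
    hU.charFun_increment s t hst, ← Complex.exp_add, h3, levyExponent_eq hint]
  congr 1
  rw [RCLike.inner_apply, RCLike.conj_to_real]
  generalize ∫ u, (Complex.exp ((σ * ξ * u : ℝ) * Complex.I) - 1) ∂Pi = J
  simp only [d]
  push_cast
  ring

variable (hσ : σ = 1 ∨ σ = -1)

include hσ in
theorem abs_orientation_mul (u : ℝ) : |σ * u| = |u| := by
  rcases hσ with rfl | rfl <;> simp

include hσ in
theorem integrable_incrementLevyMeasure (hint : Integrable (fun u => min |u| 1) Pi)
    (s t : ℝ≥0) : Integrable (fun u => min |u| 1) (incrementLevyMeasure Pi σ s t) := by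
  refine Integrable.smul_measure_nnreal ?_
  rw [integrable_map_measure (by fun_prop) (by fun_prop)]
  simpa only [Function.comp_def, abs_orientation_mul hσ] using hint

theorem incrementLevyMeasure_Iio_zero (hone : Pi {u | σ * u < 0} = 0) (s t : ℝ≥0) :
    incrementLevyMeasure Pi σ s t (Iio 0) = 0 := by
  rw [incrementLevyMeasure, Measure.smul_apply, Measure.map_apply (by fun_prop) measurableSet_Iio]
  have : (fun u => σ * u) ⁻¹' Iio 0 = {u | σ * u < 0} := rfl
  rw [this, hone, smul_zero]

-- Each increment has the characteristic function of a law with Lévy measure on `[0, ∞)`, hence is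
-- almost surely nonnegative. A countable dense set of times and right-continuity make this
-- simultaneous.
include hσ in
theorem IsPureJumpLevyProcess.ae_monotone_monotonePart (hU : IsPureJumpLevyProcess U Pi P)
    (hint : Integrable (fun u => min |u| 1) Pi) (hone : Pi {u | σ * u < 0} = 0) :
    ∀ᵐ ω ∂P, Monotone fun t => monotonePart Pi U σ t ω := by
  have hpair : ∀ s t : ℝ≥0, s ≤ t →
      ∀ᵐ ω ∂P, monotonePart Pi U σ s ω ≤ monotonePart Pi U σ t ω := by
    intro s t hst
    have hm : AEMeasurable (monotonePart Pi U σ t - monotonePart Pi U σ s) P :=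
      (hU.aemeasurable_monotonePart t).sub (hU.aemeasurable_monotonePart s)
    have := Measure.isProbabilityMeasure_map hm
    have h0 := measure_Iio_zero_of_charFun (integrable_incrementLevyMeasure hσ hint s t)
      (incrementLevyMeasure_Iio_zero hone s t) (hU.charFun_monotonePart_sub hint hst)
    rw [Measure.map_apply_of_aemeasurable hm measurableSet_Iio] at h0
    rw [ae_iff]
    refine measure_mono_null (fun ω hω => ?_) h0
    simpa using hω
  obtain ⟨D, hDc, hDd⟩ := TopologicalSpace.exists_countable_dense ℝ≥0
  have hall : ∀ᵐ ω ∂P, ∀ s ∈ D, ∀ t ∈ D, s ≤ t →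
      monotonePart Pi U σ s ω ≤ monotonePart Pi U σ t ω := by
    refine (ae_ball_iff hDc).2 fun s _ => (ae_ball_iff hDc).2 fun t _ => ?_
    by_cases hst : s ≤ t
    · filter_upwards [hpair s t hst] with ω hω _ using hω
    · exact ae_of_all _ fun ω h => absurd h hst
  filter_upwards [hall, hU.cadlag] with ω hω hcad
  have hright : ∀ t, Tendsto (fun r => monotonePart Pi U σ r ω) (𝓝[>] t)
      (𝓝 (monotonePart Pi U σ t ω)) := by
    intro t
    have h1 : Tendsto (fun r => U r ω) (𝓝[>] t) (𝓝 (U t ω)) :=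
      (hcad t).1.tendsto.mono_left (nhdsWithin_mono _ Ioi_subset_Ici_self)
    have h2 : Tendsto (fun r : ℝ≥0 => (r : ℝ)) (𝓝[>] t) (𝓝 (t : ℝ)) :=
      (NNReal.continuous_coe.tendsto t).mono_left nhdsWithin_le_nhds
    exact (h1.add (h2.const_mul _)).const_mul σ
  have hDright : ∀ t : ℝ≥0, (𝓝[>] t ⊓ 𝓟 D).NeBot := by
    intro t
    rw [← frequently_mem_iff_neBot]
    intro hev
    obtain ⟨u, hu, hsub⟩ := (mem_nhdsGT_iff_exists_Ioo_subset).1 hev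
    obtain ⟨r, hrD, hr⟩ := hDd.exists_between hu
    exact hsub hr hrD
  -- The endpoints are approximated from the right one at a time: first `s`, with the later time
  -- kept in `D`, then `t`.
  have hle : ∀ s t : ℝ≥0, s ≤ t → ∀ r ∈ D, t < r →
      monotonePart Pi U σ s ω ≤ monotonePart Pi U σ r ω := by
    intro s t hst r hrD hr
    have := hDright s
    refine le_of_tendsto ((hright s).mono_left (inf_le_left : 𝓝[>] s ⊓ 𝓟 D ≤ _)) ?_
    have h1 : ∀ᶠ q in 𝓝[>] s ⊓ 𝓟 D, q < r :=
      (inf_le_left : 𝓝[>] s ⊓ 𝓟 D ≤ _)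
        (mem_nhdsWithin_of_mem_nhds (Iio_mem_nhds (hst.trans_lt hr)))
    have h2 : ∀ᶠ q in 𝓝[>] s ⊓ 𝓟 D, q ∈ D :=
      (inf_le_right : 𝓝[>] s ⊓ 𝓟 D ≤ _) (mem_principal_self D)
    filter_upwards [h1, h2] with q hq hqD
    exact hω q hqD r hrD hq.le
  intro s t hst
  have := hDright t
  refine ge_of_tendsto ((hright t).mono_left (inf_le_left : 𝓝[>] t ⊓ 𝓟 D ≤ _)) ?_
  have h1 : ∀ᶠ q in 𝓝[>] t ⊓ 𝓟 D, t < q :=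
    (inf_le_left : 𝓝[>] t ⊓ 𝓟 D ≤ _) self_mem_nhdsWithin
  have h2 : ∀ᶠ q in 𝓝[>] t ⊓ 𝓟 D, q ∈ D :=
    (inf_le_right : 𝓝[>] t ⊓ 𝓟 D ≤ _) (mem_principal_self D)
  filter_upwards [h1, h2] with q hq hqD
  exact hle s t hst q hqD hq

include hσ in
/-- Lower bound for the probability that the monotone part stays small, in terms of the truncated
first absolute moment of the Lévy measure. -/
theorem IsPureJumpLevyProcess.le_measure_monotonePart_le (hU : IsPureJumpLevyProcess U Pi P)
    (hint : Integrable (fun u => min |u| 1) Pi) (hone : Pi {u | σ * u < 0} = 0) (t : ℝ≥0)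
    {ε κ : ℝ} (hε : 0 < ε) (hκ : 0 < κ)
    (h : (t : ℝ≥0∞) * ∫⁻ u, ENNReal.ofReal (min |u| ε) ∂Pi ≤ ENNReal.ofReal (κ * ε)) :
    ENNReal.ofReal (Real.exp (-κ) / 2) ≤ P {ω | monotonePart Pi U σ t ω ≤ 2 * (κ * ε)} := by
  have hm : AEMeasurable (monotonePart Pi U σ t - monotonePart Pi U σ 0) P :=
    (hU.aemeasurable_monotonePart t).sub (hU.aemeasurable_monotonePart 0)
  have := Measure.isProbabilityMeasure_map hm
  set Q := incrementLevyMeasure Pi σ 0 t with hQ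
  have hlint : ∫⁻ u, ENNReal.ofReal (min |u| ε) ∂Q ≤ ENNReal.ofReal (κ * ε) := by
    refine le_trans (le_of_eq ?_) h
    rw [hQ, incrementLevyMeasure, lintegral_smul_measure, lintegral_map (by fun_prop) (by fun_prop)]
    simp only [abs_orientation_mul hσ, tsub_zero]
    rfl
  -- The single bound `∫ min(|u|, ε) dQ ≤ κ ε` gives both inputs: on `[ε, ∞)` the integrand equals
  -- `ε`, so `Q([ε, ∞)) ≤ κ`; on `(-∞, ε)` it dominates `u`, so the small jumps have mean at most `κ
  -- ε = η / 2`.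
  have key := le_measure_Iic_of_charFun (integrable_incrementLevyMeasure hσ hint 0 t)
    (incrementLevyMeasure_Iio_zero hone 0 t) (hU.charFun_monotonePart_sub hint zero_le)
    (ε := ε) (κ := κ) (η := 2 * (κ * ε)) (by positivity) ?_ hκ.le ?_
  · rw [Measure.map_apply_of_aemeasurable hm measurableSet_Iic] at key
    refine key.trans (measure_mono_ae ?_)
    filter_upwards [hU.zero] with ω hω hle
    have hle' : monotonePart Pi U σ t ω - monotonePart Pi U σ 0 ω ≤ 2 * (κ * ε) := hle
    have h0 : monotonePart Pi U σ 0 ω = 0 := by simp [monotonePart, hω]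
    rw [h0, sub_zero] at hle'
    exact hle'
  · have hmark : ENNReal.ofReal ε * Q (Ici ε) ≤ ENNReal.ofReal (κ * ε) := by
      refine le_trans ?_ hlint
      refine le_trans ?_ (mul_meas_ge_le_lintegral (by fun_prop) (ENNReal.ofReal ε))
      gcongr
      intro u hu
      exact ENNReal.ofReal_le_ofReal (le_min (le_trans hu (le_abs_self u)) le_rfl)
    rw [mul_comm, ENNReal.ofReal_mul hκ.le] at hmark
    exact (ENNReal.mul_le_mul_iff_left (by simpa using hε) ENNReal.ofReal_ne_top).1 hmark
  · rw [mul_div_cancel_left₀ _ (two_ne_zero)]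
    refine le_trans ?_ hlint
    refine le_trans (setLIntegral_mono' measurableSet_Iio fun u hu => ?_)
      (setLIntegral_le_lintegral (Iio ε) _)
    refine ENNReal.ofReal_le_ofReal (le_min (le_abs_self u) (le_of_lt hu))

end MonotonePart

/-! ### The law of the solution near the edge of its support -/

section Solution

variable {Ω : Type*} [MeasurableSpace Ω] {P : Measure Ω} [IsProbabilityMeasure P]
  {Pi : Measure ℝ} {U X : ℝ≥0 → Ω → ℝ} {σ : ℝ} {x : ℝ} {a : ℝ → ℝ} {L : ℝ≥0}

omit [MeasurableSpace Ω] in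
/-- Two solution paths driven by monotone parts `S` and `S'` differ in the direction `σ` by at most
a multiple of `S`. -/
theorem solution_path_le (hσ : σ = 1 ∨ σ = -1) (ha : LipschitzWith L a) {ω ω' : Ω}
    (hX : ∀ t : ℝ≥0, IntervalIntegrable (fun s : ℝ => a (X s.toNNReal ω)) volume 0 t ∧
      X t ω = x + (∫ s in (0 : ℝ)..t, a (X s.toNNReal ω)) + U t ω)
    (hX' : ∀ t : ℝ≥0, IntervalIntegrable (fun s : ℝ => a (X s.toNNReal ω')) volume 0 t ∧
      X t ω' = x + (∫ s in (0 : ℝ)..t, a (X s.toNNReal ω')) + U t ω')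
    (hU0 : U 0 ω = 0) (hU0' : U 0 ω' = 0)
    (hS : Monotone fun t => monotonePart Pi U σ t ω)
    (hS' : Monotone fun t => monotonePart Pi U σ t ω') (t : ℝ≥0) :
    σ * X t ω ≤ σ * X t ω' + monotonePart Pi U σ t ω * Real.exp (L * t) := by
  -- In the difference of the two equations the initial point and the compensator drift cancel,
  -- leaving a Lipschitz term and the difference of the two monotone parts.
  have key := le_mul_exp_of_monotone_forcing (t := t) (K := L)
    (z := fun s => σ * (X s.toNNReal ω - X s.toNNReal ω'))
    (h := fun s => σ * (a (X s.toNNReal ω) - a (X s.toNNReal ω')))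
    (S₁ := fun s => monotonePart Pi U σ s.toNNReal ω)
    (S₂ := fun s => monotonePart Pi U σ s.toNNReal ω')
    t.coe_nonneg L.coe_nonneg (((hX t).1.sub (hX' t).1).const_mul σ) ?_ ?_
    ((hS.comp fun _ _ h => Real.toNNReal_mono h).monotoneOn _) ((hS'.comp fun _ _ h => Real.toNNReal_mono h).monotoneOn _)
    (by simp [monotonePart, hU0]) (by simp [monotonePart, hU0'])
  · simp only [Real.toNNReal_coe] at key
    linarith
  · intro s hs
    have h1 := hX s.toNNReal
    have h2 := hX' s.toNNReal
    rw [Real.coe_toNNReal s hs.1] at h1 h2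
    rw [intervalIntegral.integral_const_mul, intervalIntegral.integral_sub h1.1 h2.1, h1.2, h2.2]
    simp only [monotonePart]
    ring
  · intro s _
    rw [abs_orientation_mul hσ, abs_orientation_mul hσ]
    have := ha.dist_le_mul (X s.toNNReal ω) (X s.toNNReal ω')
    rwa [Real.dist_eq, Real.dist_eq] at this

/-- There is an edge `z` of the support of `X t` such that the solution is near `z` whenever the
monotone part of the driving process is small. -/
theorem exists_edge (hσ : σ = 1 ∨ σ = -1) (ha : LipschitzWith L a)
    (hU : IsPureJumpLevyProcess U Pi P) (hX : IsSDESolution X x a U P)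
    (hint : Integrable (fun u => min |u| 1) Pi) (hone : Pi {u | σ * u < 0} = 0) (t : ℝ≥0) :
    ∃ z : ℝ, (∀ᵐ ω ∂P, 0 ≤ σ * (X t ω - z)) ∧
      ∀ᵐ ω ∂P, σ * (X t ω - z) ≤ monotonePart Pi U σ t ω * Real.exp (L * t) := by
  set good : Ω → Prop := fun ω =>
    (∀ t : ℝ≥0, IntervalIntegrable (fun s : ℝ => a (X s.toNNReal ω)) volume 0 t ∧
      X t ω = x + (∫ s in (0 : ℝ)..t, a (X s.toNNReal ω)) + U t ω) ∧ U 0 ω = 0 ∧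
      Monotone fun t => monotonePart Pi U σ t ω with hgood
  have hgood_ae : ∀ᵐ ω ∂P, good ω := by
    filter_upwards [hX.eqn, hU.zero, hU.ae_monotone_monotonePart hσ hint hone] with ω h1 h2 h3
    exact ⟨h1, h2, h3⟩
  have hcomp : ∀ ω ω', good ω → good ω' →
      σ * X t ω - monotonePart Pi U σ t ω * Real.exp (L * t) ≤ σ * X t ω' := by
    intro ω ω' h h'
    have := solution_path_le hσ ha h.1 h'.1 h.2.1 h'.2.1 h.2.2 h'.2.2 t
    linarith
  obtain ⟨ω₀, hω₀⟩ := hgood_ae.exists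
  -- The edge is the infimum of `σ X_t` over all good paths. Pairwise comparison of paths suffices,
  -- so the jump-free equation need not be solved.
  set A : Set ℝ := (fun ω => σ * X t ω) '' {ω | good ω} with hA
  have hAne : A.Nonempty := ⟨_, ω₀, hω₀, rfl⟩
  have hAb : BddBelow A := by
    refine ⟨σ * X t ω₀ - monotonePart Pi U σ t ω₀ * Real.exp (L * t), ?_⟩
    rintro _ ⟨ω, hω, rfl⟩
    exact hcomp ω₀ ω hω₀ hω
  have hσσ : σ * (σ * sInf A) = sInf A := by
    rcases hσ with rfl | rfl <;> ring
  refine ⟨σ * sInf A, ?_, ?_⟩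
  · filter_upwards [hgood_ae] with ω hω
    rw [mul_sub, hσσ, sub_nonneg]
    exact csInf_le hAb ⟨ω, hω, rfl⟩
  · filter_upwards [hgood_ae] with ω hω
    rw [mul_sub, hσσ, sub_le_comm]
    refine le_csInf hAne ?_
    rintro _ ⟨ω', hω', rfl⟩
    exact hcomp ω ω' hω hω'

end Solution

/-! ### Choice of the scale `ε` and the final contradiction. -/

theorem integrable_min_abs_one {Pi : Measure ℝ} {ε : ℝ} (hε : 0 < ε)
    (h : ∫⁻ u, ENNReal.ofReal (min |u| ε) ∂Pi < ∞) : Integrable (fun u => min |u| 1) Pi := by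
  have h1 : Integrable (fun u => min |u| ε) Pi :=
    (lintegral_ofReal_ne_top_iff_integrable (by fun_prop)
      (ae_of_all _ fun u => le_min (abs_nonneg u) hε.le)).1 h.ne
  refine (h1.const_mul (1 + 1 / ε)).mono' (by fun_prop) (ae_of_all _ fun u => ?_)
  rw [Real.norm_of_nonneg (le_min (abs_nonneg u) zero_le_one)]
  have hd : 0 < 1 / ε := by positivity
  rcases le_total |u| ε with h' | h'
  · rw [min_eq_left h']
    refine (min_le_left _ _).trans ?_
    nlinarith [abs_nonneg u]
  · rw [min_eq_right h']
    refine (min_le_right _ _).trans ?_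
    have : 1 / ε * ε = 1 := by field_simp
    nlinarith

theorem frequently_truncated_moment_le {Pi : Measure ℝ} (hρ : upperOrderIndex 1 Pi < ∞)
    {t : ℝ≥0} {m : ℝ≥0} (hm : (t : ℝ≥0∞) * upperOrderIndex 1 Pi < m) :
    ∃ᶠ ε in 𝓝[>] (0 : ℝ), ∫⁻ u, ENNReal.ofReal (min |u| ε) ∂Pi < ∞ ∧
      (t : ℝ≥0∞) * ∫⁻ u, ENNReal.ofReal (min |u| ε) ∂Pi
        ≤ ENNReal.ofReal (m * Real.log (1 / ε) * ε) := by
  have hlt : upperOrderIndex 1 Pi < m / t := by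
    -- For `t = 0` the quotient `m / t` is `∞`, and finiteness of the index is what is needed.
    rcases eq_or_ne t 0 with rfl | ht
    · have hm0 : (m : ℝ≥0∞) ≠ 0 := (bot_le.trans_lt hm).ne'
      rw [ENNReal.coe_zero, ENNReal.div_zero hm0]
      exact hρ
    · rw [ENNReal.lt_div_iff_mul_lt (Or.inl (by simpa using ht)) (Or.inl ENNReal.coe_ne_top),
        mul_comm]
      exact hm
  have hfreq : ∃ᶠ ε in 𝓝[>] (0 : ℝ), orderFun 1 Pi ε < m / t :=
    frequently_lt_of_liminf_lt (by isBoundedDefault) hlt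
  have hsmall : ∀ᶠ ε in 𝓝[>] (0 : ℝ), ε ∈ Ioo (0 : ℝ) 1 := Ioo_mem_nhdsGT one_pos
  refine (hfreq.and_eventually hsmall).mono ?_
  rintro ε ⟨hε, h0, h1⟩
  have hlog : 0 < Real.log (1 / ε) := Real.log_pos (by rw [lt_div_iff₀ h0]; linarith)
  have hpos : 0 < ε * Real.log (1 / ε) := mul_pos h0 hlog
  simp only [orderFun, pow_one] at hε
  set I := ∫⁻ u, ENNReal.ofReal (min |u| ε) ∂Pi
  refine ⟨?_, ?_⟩
  · by_contra hI
    rw [not_lt, top_le_iff] at hI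
    rw [hI, ENNReal.top_div_of_ne_top ENNReal.ofReal_ne_top] at hε
    exact not_top_lt hε
  · have h2 : (t : ℝ≥0∞) * (I / ENNReal.ofReal (ε * Real.log (1 / ε))) ≤ m := by
      rw [mul_comm]
      exact (ENNReal.mul_lt_of_lt_div hε).le
    rw [← mul_div_assoc, ENNReal.div_le_iff (by simpa using hpos) ENNReal.ofReal_ne_top] at h2
    refine h2.trans_eq ?_
    rw [← ENNReal.ofReal_coe_nnreal, ← ENNReal.ofReal_mul m.coe_nonneg]
    congr 1
    ring

/-- With `l = log(1/ε)`, so `ε = exp(-l)`, the claim is that `l ^ n` is negligible against `exp((n -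
m) l)`. -/
theorem eventually_mul_log_pow_lt {m : ℝ} {n : ℕ} (hm : m < n) (C : ℝ) :
    ∀ᶠ ε in 𝓝[>] (0 : ℝ),
      C * (Real.log (1 / ε) * ε) ^ n < Real.exp (-(m * Real.log (1 / ε))) := by
  have hlog : Tendsto (fun ε : ℝ => Real.log (1 / ε)) (𝓝[>] 0) atTop := by
    simp only [one_div]
    exact Real.tendsto_log_atTop.comp tendsto_inv_nhdsGT_zero
  have hC : 0 < (|C| + 1)⁻¹ := by positivity
  have hlittle := (isLittleO_pow_exp_pos_mul_atTop (b := n - m) n (by linarith)).def hC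
  filter_upwards [hlog.eventually hlittle, hlog.eventually (eventually_gt_atTop 0),
    self_mem_nhdsWithin] with ε h1 h2 hε
  set l := Real.log (1 / ε) with hl
  have hεl : ε = Real.exp (-l) := by
    rw [hl, one_div, Real.log_inv, neg_neg, Real.exp_log hε]
  rw [Real.norm_of_nonneg (by positivity), Real.norm_of_nonneg (by positivity)] at h1
  have h3 : (|C| + 1) * l ^ n ≤ Real.exp ((n - m) * l) := by
    rw [inv_mul_eq_div, le_div_iff₀ (by positivity)] at h1
    linarith
  have h4 : C * l ^ n < Real.exp ((n - m) * l) := by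
    have : 0 < l ^ n := by positivity
    nlinarith [le_abs_self C]
  have h5 : Real.exp (-(m * l)) = Real.exp ((n - m) * l) * ε ^ n := by
    rw [hεl, ← Real.exp_nat_mul, ← Real.exp_add]
    congr 1
    ring
  rw [h5, mul_pow, ← mul_assoc]
  have : 0 < ε ^ n := pow_pos hε n
  gcongr

theorem not_memCB_of_orientation {Ω : Type*} [MeasurableSpace Ω] {P : Measure Ω}
    [IsProbabilityMeasure P] {Pi : Measure ℝ} {σ : ℝ} (hσ : σ = 1 ∨ σ = -1)
    (hone : Pi {u | σ * u < 0} = 0) (hρ : upperOrderIndex 1 Pi < ∞)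
    {a : ℝ → ℝ} {L : ℝ≥0} (ha : LipschitzWith L a)
    {U : ℝ≥0 → Ω → ℝ} (hU : IsPureJumpLevyProcess U Pi P)
    {x : ℝ} {X : ℝ≥0 → Ω → ℝ} (hX : IsSDESolution X x a U P)
    {t : ℝ≥0} {p : ℝ → ℝ} (hp : IsLebesgueDensity p (P.map (X t)))
    {k : ℕ} (ht : (t : ℝ≥0∞) * upperOrderIndex 1 Pi < (k : ℝ≥0∞) + 1) :
    ¬ MemCB k p := by
  intro hCB
  obtain ⟨m', hm1, hm2⟩ := exists_between ht
  lift m' to ℝ≥0 using (hm2.trans_le le_top).ne with m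
  have hmk : (m : ℝ) < ((k + 1 : ℕ) : ℝ) := by
    have : m < ((k + 1 : ℕ) : ℝ≥0) := by
      rw [← ENNReal.coe_lt_coe]
      exact_mod_cast hm2
    exact_mod_cast this
  have hm0 : 0 < (m : ℝ) := by
    have : (0 : ℝ≥0∞) < m := bot_le.trans_lt hm1
    exact_mod_cast this
  have hfreq := frequently_truncated_moment_le hρ hm1
  have hsmall : ∀ᶠ ε in 𝓝[>] (0 : ℝ), ε ∈ Ioo (0 : ℝ) 1 := Ioo_mem_nhdsGT one_pos
  obtain ⟨ε₀, ⟨hε₀, -⟩, hε₀pos, -⟩ := (hfreq.and_eventually hsmall).exists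
  have hint := integrable_min_abs_one hε₀pos hε₀
  obtain ⟨z, hz0, hz1⟩ := exists_edge hσ ha hU hX hint hone t
  have := Measure.isProbabilityMeasure_map (hX.aemeasurable t)
  obtain ⟨C, hC, hbound⟩ := measure_le_of_memCB hp hCB
  set E := Real.exp (L * t) with hE
  have hEpos : 0 < E := Real.exp_pos _
  -- The leading `2` clears the `1 / 2` of the lower estimate; `(2 m E) ^ (k + 1)` comes from `δ = 2
  -- m E · (l ε)`, chosen below.
  have hev := eventually_mul_log_pow_lt hmk (2 * (C * (2 * m * E) ^ (k + 1)))
  obtain ⟨ε, ⟨-, hmom⟩, ⟨hε0, hε1⟩, hlt⟩ := (hfreq.and_eventually (hsmall.and hev)).exists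
  have hlog : 0 < Real.log (1 / ε) := Real.log_pos (by rw [lt_div_iff₀ hε0]; linarith)
  set l := Real.log (1 / ε)
  have hlow := hU.le_measure_monotonePart_le hσ hint hone t hε0 (mul_pos hm0 hlog) hmom
  -- The event `S_t ≤ 2 κ ε` with `κ = m l` forces `σ (X_t - z) ≤ δ`, so both estimates concern the
  -- same neighbourhood of the edge.
  set δ := 2 * (m * l * ε) * E with hδ
  have hδpos : 0 < δ := by positivity
  have hσ0 : σ ≠ 0 := by rcases hσ with rfl | rfl <;> norm_num
  have hmeas : ∀ s : Set ℝ, MeasurableSet s →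
      P.map (X t) {y | σ / δ * (y - z) ∈ s} = P {ω | σ / δ * (X t ω - z) ∈ s} := by
    intro s hs
    exact Measure.map_apply_of_aemeasurable (hX.aemeasurable t)
      ((by fun_prop : Measurable fun y => σ / δ * (y - z)) hs)
  have hscale : ∀ y, σ / δ * (y - z) = σ * (y - z) / δ := fun y => by ring
  have hup := hbound (σ / δ) z (div_ne_zero hσ0 hδpos.ne') (by
    refine (hmeas _ measurableSet_Iio).trans ?_
    have : ∀ᵐ ω ∂P, ¬ (σ / δ * (X t ω - z) ∈ Iio (0 : ℝ)) := by
      filter_upwards [hz0] with ω hω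
      rw [mem_Iio, not_lt, hscale]
      positivity
    simpa [ae_iff] using this)
  have habs : |σ / δ|⁻¹ = δ := by
    rw [abs_div, abs_of_pos hδpos]
    rcases hσ with rfl | rfl <;> simp
  rw [habs] at hup
  have hle : ENNReal.ofReal (Real.exp (-(m * l)) / 2) ≤ ENNReal.ofReal (C * δ ^ (k + 1)) := by
    refine hlow.trans (le_trans ?_ hup)
    refine le_trans (measure_mono_ae ?_) (hmeas _ measurableSet_Iic).ge
    filter_upwards [hz1] with ω hω hle
    have hle' : monotonePart Pi U σ t ω ≤ 2 * (m * l * ε) := hle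
    change σ / δ * (X t ω - z) ≤ 1
    rw [hscale, div_le_one hδpos]
    exact hω.trans (mul_le_mul_of_nonneg_right hle' hEpos.le)
  rw [ENNReal.ofReal_le_ofReal_iff (by positivity)] at hle
  have hδ' : δ ^ (k + 1) = (2 * m * E) ^ (k + 1) * (l * ε) ^ (k + 1) := by
    rw [← mul_pow, hδ]
    ring
  rw [hδ'] at hle
  linarith

theorem proposition2p4 {Ω : Type*} [MeasurableSpace Ω] (P : Measure Ω) [IsProbabilityMeasure P]
    (Pi : Measure ℝ) (hPi : IsLevyMeasure Pi)
    (hone : Pi (Iio 0) * Pi (Ioi 0) = 0)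
    (hρ : upperOrderIndex 1 Pi < ∞)
    (a : ℝ → ℝ) (L : ℝ≥0) (ha : LipschitzWith L a)
    (U : ℝ≥0 → Ω → ℝ) (hU : IsPureJumpLevyProcess U Pi P)
    (x : ℝ) (X : ℝ≥0 → Ω → ℝ) (hX : IsSDESolution X x a U P)
    (t : ℝ≥0) (p : ℝ → ℝ) (hp : IsLebesgueDensity p (P.map (X t)))
    (k : ℕ) (ht : (t : ℝ≥0∞) * upperOrderIndex 1 Pi < (k : ℝ≥0∞) + 1) :
    ¬ MemCB k p := by
  rcases mul_eq_zero.1 hone with h | h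
  · refine not_memCB_of_orientation (σ := 1) (Or.inl rfl) ?_ hρ ha hU hX hp ht
    simpa [Iio_def] using h
  · refine not_memCB_of_orientation (σ := -1) (Or.inr rfl) ?_ hρ ha hU hX hp ht
    simpa [Ioi_def] using h
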